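/- Let $\Bbbk$ be a field, let $A=\Bbbk[X_1,\dots,X_r]$ with $r\ge 0$, and let $\mathfrak m=(X_1,\dots,X_r)$. For an ideal $J\subseteq A$, let $\overline J$ be its integral closure, that is, the set of all $x\in A$ satisfying an equation $x^n+a_1x^{n-1}+\dots+a_n=0$ with $n\ge 1$ and $a_i\in J^i$ for $1\le i\le n$. If $J$ is a monomial ideal, let $\delta^*(J)$ be the ideal generated by all $f/x$, where $f$ is a minimal monomial generator of $J$ and $x$ is a variable dividing $f$. Let $I\subsetneq A$ be a proper monomial ideal, with the convention $I^0=A$. Then: (1) $\{\overline{I^k}\}_{k\in\mathbb N}$ is a Tor-vanishing filtration of ideals. That is, $\overline{I^0}=A$, and for all $k,l\ge 0$ we have $\overline{I^{k+1}}\subseteq\overline{I^k}$ and $\overline{I^k}\cdot\overline{I^l}\subseteq\overline{I^{k+l}}$; moreover, for every $k\ge 1$ and every $i\ge 0$, the map $$\operatorname{Tor}^A_i(\Bbbk,\overline{I^k})\to\operatorname{Tor}^A_i(\Bbbk,\overline{I^{k-1}})$$ induced by the inclusion $\overline{I^k}\subseteq\overline{I^{k-1}}$ is zero, where $\Bbbk=A/\mathfrak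 m$. (2) For every $k\ge 1$, $\overline{I^k}\subseteq\mathfrak m\cdot\overline{I^{k-1}}$. (3) For every $k\ge 1$, $\delta^*(\overline{I^k})\subseteq\overline{I^{k-1}}$. -/

import Mathlib

universe u

namespace IntClosure

section IntegralClosure

variable {R : Type*} [CommRing R]

/-- `x` is integral over the ideal `I`: it satisfies an equation
`x ^ n + a 1 * x ^ (n - 1) + ⋯ + a (n - 1) * x + a n = 0` with `n ≥ 1` and `a i ∈ I ^ i`. -/
def IsIntegralOverIdeal (I : Ideal R) (x : R) : Prop :=
  ∃ (n : ℕ) (a : ℕ → R), 1 ≤ n ∧ (∀ i, 1 ≤ i → i ≤ n → a i ∈ I ^ i) ∧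
    x ^ n + ∑ i ∈ Finset.Icc 1 n, a i * x ^ (n - i) = 0

end IntegralClosure

/-- Integrality over the power `I ^ d` is integrality of `x T ^ d` over the Rees algebra of `I`. -/
theorem isIntegralOverIdeal_pow_iff {R : Type u} [CommRing R] (I : Ideal R) (d : ℕ) (x : R) :
    IsIntegralOverIdeal (I ^ d) x ↔ IsIntegral (reesAlgebra I) (Polynomial.monomial d x) := by
  constructor
  · rintro ⟨n, a, hn, ha, h⟩
    have hmem : ∀ i, (if 1 ≤ i ∧ i ≤ n then Polynomial.monomial (d * i) (a i) else 0)
        ∈ reesAlgebra I := by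
      intro i
      split_ifs with hi
      · rw [reesAlgebra.monomial_mem, pow_mul]
        exact ha i hi.1 hi.2
      · exact Subalgebra.zero_mem _
    let c : ℕ → reesAlgebra I := fun i => ⟨_, hmem i⟩
    let q : Polynomial (reesAlgebra I) :=
      ∑ i ∈ Finset.Icc 1 n, Polynomial.C (c i) * Polynomial.X ^ (n - i)
    refine ⟨Polynomial.X ^ n + q, ?_, ?_⟩
    · apply Polynomial.monic_X_pow_add
      apply lt_of_le_of_lt (Polynomial.degree_sum_le _ _)
      rw [Finset.sup_lt_iff (by exact WithBot.bot_lt_coe n)]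
      intro i hi
      rw [Finset.mem_Icc] at hi
      refine lt_of_le_of_lt (Polynomial.degree_C_mul_X_pow_le _ _) ?_
      exact_mod_cast (by omega : n - i < n)
    · simp only [q, Polynomial.eval₂_add, Polynomial.eval₂_finsetSum, Polynomial.eval₂_mul,
        Polynomial.eval₂_C, Polynomial.eval₂_pow, Polynomial.eval₂_X]
      have key : ∀ i ∈ Finset.Icc 1 n,
          (algebraMap (reesAlgebra I) (Polynomial R)) (c i) * Polynomial.monomial d x ^ (n - i)
            = Polynomial.monomial (d * n) (a i * x ^ (n - i)) := by
        intro i hi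
        rw [Finset.mem_Icc] at hi
        have : (algebraMap (reesAlgebra I) (Polynomial R)) (c i)
            = Polynomial.monomial (d * i) (a i) := by
          change (if 1 ≤ i ∧ i ≤ n then Polynomial.monomial (d * i) (a i) else 0) = _
          rw [if_pos hi]
        rw [this, Polynomial.monomial_pow, Polynomial.monomial_mul_monomial, ← mul_add,
          Nat.add_sub_cancel' hi.2]
      rw [Finset.sum_congr rfl key, ← map_sum, Polynomial.monomial_pow, ← map_add, h, map_zero]
  · rintro ⟨p, hp, h⟩
    rcases Nat.eq_zero_or_pos p.natDegree with h0 | hpos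
    · have h1 : p = 1 := hp.natDegree_eq_zero.mp h0
      rw [h1, Polynomial.eval₂_one] at h
      have h2 : (1 : R) = 0 := by
        have := congrArg (fun f => Polynomial.coeff f 0) h
        simpa using this
      refine ⟨1, fun _ => 0, le_rfl, fun _ _ _ => Submodule.zero_mem _, ?_⟩
      calc _ = (1 : R) * _ := (one_mul _).symm
        _ = 0 := by rw [h2, zero_mul]
    · set n := p.natDegree with hn
      refine ⟨n, fun i => (p.coeff (n - i) : Polynomial R).coeff (d * i), hpos, ?_, ?_⟩
      · intro i _ _
        rw [← pow_mul]
        exact (p.coeff (n - i)).2 (d * i)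
      · have h1 := congrArg (fun f => Polynomial.coeff f (d * n)) h
        simp only [Polynomial.eval₂_eq_sum_range, Polynomial.coeff_zero,
          Polynomial.finsetSum_coeff] at h1
        rw [← hn, ← Finset.sum_range_reflect, Finset.sum_range_succ'] at h1
        have e : ∀ i, i ≤ n → ((algebraMap (reesAlgebra I) (Polynomial R)) (p.coeff (n - i))
              * Polynomial.monomial d x ^ (n - i)).coeff (d * n)
            = (p.coeff (n - i) : Polynomial R).coeff (d * i) * x ^ (n - i) := by
          intro i hi
          have e1 : d * n = d * i + d * (n - i) := by rw [← mul_add]; congr 1; omega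
          rw [Polynomial.monomial_pow, e1, Polynomial.coeff_mul_monomial]
          rfl
        have e0 := e 0 (Nat.zero_le _)
        have lead : (p.coeff n : Polynomial R).coeff 0 = 1 := by
          rw [hn, hp.coeff_natDegree]; simp
        simp only [Nat.add_sub_cancel, Nat.sub_zero, mul_zero] at h1 e0
        rw [e0, lead, one_mul] at h1
        rw [add_comm, ← h1, Finset.range_eq_Ico, ← Finset.Ico_add_one_right_eq_Icc,
          Finset.sum_Ico_eq_sum_range]
        congr 1
        rw [Nat.add_sub_cancel, Finset.range_eq_Ico]
        refine Finset.sum_congr rfl fun i hi => ?_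
        rw [Finset.mem_Ico] at hi
        rw [add_comm 1 i, ← e (i + 1) (by omega)]

theorem isIntegralOverIdeal_iff {R : Type u} [CommRing R] (I : Ideal R) (x : R) :
    IsIntegralOverIdeal I x ↔ IsIntegral (reesAlgebra I) (Polynomial.monomial 1 x) := by
  rw [← isIntegralOverIdeal_pow_iff, pow_one]

/-- The integral closure of an ideal. -/
def integralClosureIdeal {R : Type u} [CommRing R] (I : Ideal R) : Ideal R where
  carrier := {x | IsIntegralOverIdeal I x}
  zero_mem' := by
    rw [Set.mem_ofPred_eq, isIntegralOverIdeal_iff, map_zero]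
    exact isIntegral_zero
  add_mem' := by
    intro x y hx hy
    rw [Set.mem_ofPred_eq, isIntegralOverIdeal_iff] at *
    rw [map_add]
    exact hx.add hy
  smul_mem' := by
    intro c x hx
    rw [Set.mem_ofPred_eq, isIntegralOverIdeal_iff] at *
    rw [← Polynomial.smul_monomial, ← algebraMap_smul (reesAlgebra I) c]
    exact hx.smul _

theorem mem_integralClosureIdeal {R : Type u} [CommRing R] (I : Ideal R) (x : R) :
    x ∈ integralClosureIdeal I ↔ IsIntegralOverIdeal I x := Iff.rfl

section Monomial

variable {K : Type u} [Field K] {r : ℕ}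

/-- An ideal of `K[X_1, …, X_r]` generated by a set of monomials. -/
def IsMonomialIdeal (I : Ideal (MvPolynomial (Fin r) K)) : Prop :=
  ∃ s : Set (Fin r →₀ ℕ),
    I = Ideal.span ((fun a => MvPolynomial.monomial a (1 : K)) '' s)

/-- `x ^ a` is a minimal monomial generator of `I`: it lies in `I`, and it is the only monomial
in `I` that divides it. -/
def IsMinimalMonomialGenerator (I : Ideal (MvPolynomial (Fin r) K)) (a : Fin r →₀ ℕ) : Prop :=
  Minimal (fun b => MvPolynomial.monomial b (1 : K) ∈ I) a

/-- `δ*(I)`: the ideal generated by the monomials `f / x`, where `f` is a minimal monomial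
generator of `I` and `x` is a variable dividing `f`. -/
noncomputable def deltaStar (I : Ideal (MvPolynomial (Fin r) K)) : Ideal (MvPolynomial (Fin r) K) :=
  Ideal.span {g | ∃ (a : Fin r →₀ ℕ) (i : Fin r), IsMinimalMonomialGenerator I a ∧ 1 ≤ a i ∧
    g = MvPolynomial.monomial (a - Finsupp.single i 1) (1 : K)}

end Monomial

section Tor

open CategoryTheory

variable (K : Type u) [Field K] (r : ℕ)

/-- The maximal homogeneous ideal `(X_1, …, X_r)`. -/
noncomputable abbrev maxIdeal : Ideal (MvPolynomial (Fin r) K) := MvPolynomial.idealOfVars (Fin r) K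

/-- `K` as a module over `A = K[X_1, …, X_r]`, that is `A / (X_1, …, X_r)`. -/
noncomputable abbrev residueModule : ModuleCat.{u} (MvPolynomial (Fin r) K) :=
  ModuleCat.of _ (MvPolynomial (Fin r) K ⧸ maxIdeal K r)

variable {K r}

/-- `φ : M → N` is Tor-vanishing: `Tor_i(K, φ) = 0` for all `i ≥ 0`. Here `Tor_i(-, N)` is the
`i`-th left derived functor of `- ⊗ N`, so that `Tor_i(K, φ)` is the map induced by `φ` on the
homology of a projective resolution of `K` tensored with `M` and with `N`. -/
def IsTorVanishing {M N : Type u} [AddCommGroup M] [Module (MvPolynomial (Fin r) K) M]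
    [AddCommGroup N] [Module (MvPolynomial (Fin r) K) N]
    (φ : M →ₗ[MvPolynomial (Fin r) K] N) : Prop :=
  ∀ i : ℕ, ((Tor' (ModuleCat.{u} (MvPolynomial (Fin r) K)) i).obj (residueModule K r)).map
    (ModuleCat.ofHom φ) = 0

/-- A filtration of ideals all of whose inclusion maps `Q k → Q (k - 1)`, `k ≥ 1`, are
Tor-vanishing. -/
structure IsTorVanishingFiltration (Q : ℕ → Ideal (MvPolynomial (Fin r) K)) : Prop where
  zero_eq_top : Q 0 = ⊤
  succ_le : ∀ k, Q (k + 1) ≤ Q k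
  mul_le : ∀ k l, Q k * Q l ≤ Q (k + l)
  torVanishing : ∀ k, IsTorVanishing (Submodule.inclusion (succ_le k))

end Tor

end IntClosure

namespace IntClosure

open MvPolynomial

/-! ### Multigradings: integral closures of monomial ideals are monomial. -/

section Torus

variable {K : Type u} [Field K] {r : ℕ}

/-! Everything rests on one divisibility statement, `IsMonomialIdeal.monomial_sub_single_mem`:
dividing a monomial of the closure of `I ^ k` by a variable gives a monomial of the closure of `I ^
(k - 1)`. If `x ^ a` is integral over `I ^ k`, some power `x ^ (n a)` is divisible by a product of
`k n` generators of `I` (`IsMonomialIdeal.exists_pow_mem`). Discard `n` of the factors, those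
divisible by `x_i` first: what is left divides `(x ^ a / x_i) ^ n`.

This gives (3) at once. It gives (2) because the closure is a monomial ideal
(`IsMonomialIdeal.integralClosureIdeal`) inside the maximal ideal, so each of its monomials is
divisible by a variable.

For Tor, the Koszul complex has a `K`-linear contracting homotopy that divides coefficients by a
single variable. By the divisibility statement it carries coefficients in the closure of `I ^ k` to
coefficients in the closure of `I ^ (k - 1)`, so Koszul cycles over the smaller ideal bound over the
larger one (`exists_rTensor_eq_lTensor_inclusion`). -/

/-- The coaction `x_i T ^ k ↦ x_i T ^ k Y_i` of the torus on `A[T]`. -/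
noncomputable def torusCoaction (K : Type u) [Field K] (r : ℕ) :
    Polynomial (MvPolynomial (Fin r) K) →+*
      MvPolynomial (Fin r) (Polynomial (MvPolynomial (Fin r) K)) :=
  Polynomial.eval₂RingHom
    (eval₂Hom (C.comp (Polynomial.C.comp C)) fun i => C (Polynomial.C (X i)) * X i)
    (C Polynomial.X)

theorem torusCoaction_monomial (k : ℕ) (a : Fin r →₀ ℕ) (c : K) :
    torusCoaction K r (Polynomial.monomial k (monomial a c)) =
      monomial a (Polynomial.monomial k (monomial a c)) := by
  have h : (a.prod fun n e => (C (Polynomial.C (X n)) * X n :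
      MvPolynomial (Fin r) (Polynomial (MvPolynomial (Fin r) K))) ^ e) =
      monomial a (Polynomial.C (monomial a 1)) := by
    rw [monomial_eq, monomial_eq (s := a) (a := (1 : K))]
    simp only [Finsupp.prod, mul_pow, Finset.prod_mul_distrib, map_one, one_mul, map_prod, map_pow]
  simp only [torusCoaction, Polynomial.coe_eval₂RingHom, Polynomial.eval₂_monomial, coe_eval₂Hom,
    eval₂_monomial, h, RingHom.comp_apply]
  rw [← map_pow, C_mul_monomial, mul_comm, C_mul_monomial, Polynomial.X_pow_eq_monomial,
    ← Polynomial.C_mul, C_mul_monomial, Polynomial.monomial_mul_C]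
  simp

/-- This is how the coaction isolates a multigraded component: the exponent of `Y` records the
exponent of `x`. -/
theorem coeff_coeff_torusCoaction (p : Polynomial (MvPolynomial (Fin r) K)) (a : Fin r →₀ ℕ)
    (k : ℕ) : ((torusCoaction K r p).coeff a).coeff k = monomial a ((p.coeff k).coeff a) := by
  classical
  induction p using Polynomial.induction_on' with
  | add p q hp hq => simp [hp, hq]
  | monomial n p =>
    induction p using MvPolynomial.induction_on' with
    | add p q hp hq => simp only [map_add, Polynomial.coeff_add, coeff_add, hp, hq]
    | monomial b c =>
      rw [torusCoaction_monomial, coeff_monomial]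
      by_cases hb : b = a <;> by_cases hk : n = k <;>
        simp [hb, hk, Polynomial.coeff_monomial, coeff_monomial]

theorem IsMonomialIdeal.monomial_mem {J : Ideal (MvPolynomial (Fin r) K)}
    (hJ : IsMonomialIdeal J) {f : MvPolynomial (Fin r) K} (hf : f ∈ J) {a : Fin r →₀ ℕ}
    (ha : a ∈ f.support) : monomial a (1 : K) ∈ J := by
  classical
  obtain ⟨s, rfl⟩ := hJ
  rw [mem_ideal_span_monomial_image] at hf ⊢
  intro b hb
  rw [support_monomial, if_neg one_ne_zero, Finset.mem_singleton] at hb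
  exact hb ▸ hf a ha

theorem monomial_mem_of_one {J : Ideal (MvPolynomial (Fin r) K)} {a : Fin r →₀ ℕ}
    (h : monomial a (1 : K) ∈ J) (c : K) : monomial a c ∈ J := by
  rw [← mul_one c, ← C_mul_monomial]
  exact J.mul_mem_left _ h

theorem IsMonomialIdeal.monomial_coeff_mem {J : Ideal (MvPolynomial (Fin r) K)}
    (hJ : IsMonomialIdeal J) {f : MvPolynomial (Fin r) K} (hf : f ∈ J) (a : Fin r →₀ ℕ) :
    monomial a (f.coeff a) ∈ J := by
  by_cases h : a ∈ f.support
  · exact monomial_mem_of_one (hJ.monomial_mem hf h) _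
  · rw [notMem_support_iff.mp h, monomial_zero]
    exact J.zero_mem

/-- The sums of `N` exponents from `s`. -/
def sumsOf (s : Set (Fin r →₀ ℕ)) (N : ℕ) : Set (Fin r →₀ ℕ) :=
  {b | ∃ m : Multiset (Fin r →₀ ℕ), m.card = N ∧ (∀ a ∈ m, a ∈ s) ∧ m.sum = b}

theorem span_monomial_pow (s : Set (Fin r →₀ ℕ)) (N : ℕ) :
    Ideal.span ((fun a => monomial a (1 : K)) '' s) ^ N =
      Ideal.span ((fun a => monomial a (1 : K)) '' sumsOf s N) := by
  induction N with
  | zero =>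
    rw [pow_zero, Ideal.one_eq_top, eq_comm, Ideal.eq_top_iff_one]
    exact Ideal.subset_span ⟨0, ⟨0, by simp⟩, rfl⟩
  | succ N ih =>
    rw [pow_succ, ih, Ideal.span_mul_span']
    congr 1
    ext p
    constructor
    · rintro ⟨_, ⟨_, ⟨m, hm, hs, rfl⟩, rfl⟩, _, ⟨a, ha, rfl⟩, rfl⟩
      refine ⟨m.sum + a, ⟨a ::ₘ m, by simp [hm], ?_, by simp [add_comm]⟩, by simp⟩
      simpa using ⟨ha, hs⟩
    · rintro ⟨_, ⟨m, hm, hs, rfl⟩, rfl⟩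
      obtain ⟨a, ha⟩ := Multiset.card_pos_iff_exists_mem.mp (by omega : 0 < m.card)
      obtain ⟨m, rfl⟩ := Multiset.exists_cons_of_mem ha
      refine ⟨_, ⟨m.sum, ⟨m, by simpa using hm, fun b hb => hs b (by simp [hb]), rfl⟩, rfl⟩, _,
        ⟨a, hs a (by simp), rfl⟩, by simp [add_comm]⟩

theorem IsMonomialIdeal.pow {J : Ideal (MvPolynomial (Fin r) K)} (hJ : IsMonomialIdeal J) (N : ℕ) :
    IsMonomialIdeal (J ^ N) := by
  obtain ⟨s, rfl⟩ := hJ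
  exact ⟨sumsOf s N, span_monomial_pow s N⟩

/-- Powers of a monomial ideal contain the terms of their elements, so the coaction maps the Rees
algebra to polynomials in `Y` over the Rees algebra. -/
theorem torusCoaction_mem_range {J : Ideal (MvPolynomial (Fin r) K)} (hJ : IsMonomialIdeal J)
    (p : reesAlgebra J) : torusCoaction K r p ∈
      (map (σ := Fin r)
        (algebraMap (reesAlgebra J) (Polynomial (MvPolynomial (Fin r) K)))).rangeS := by
  rw [RingHom.mem_rangeS, ← Set.mem_range, mem_range_map_iff_coeffs_subset]
  intro q hq
  rw [Finset.mem_coe, mem_coeffs_iff] at hq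
  obtain ⟨a, -, rfl⟩ := hq
  refine ⟨⟨(torusCoaction K r p).coeff a, fun k => ?_⟩, rfl⟩
  rw [coeff_coeff_torusCoaction]
  exact (hJ.pow k).monomial_coeff_mem (p.2 k) a

-- The coaction carries the integrality of `f T` over the Rees algebra to integrality over
-- polynomials in `Y` with Rees coefficients. A polynomial integral over such a ring has integral
-- coefficients, and the coefficient of `Y ^ a` is the `a`-term of `f` times `T`.
attribute [local instance] MvPolynomial.algebraMvPolynomial in
theorem IsMonomialIdeal.isIntegralOverIdeal_monomial {J : Ideal (MvPolynomial (Fin r) K)}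
    (hJ : IsMonomialIdeal J) {f : MvPolynomial (Fin r) K} (hf : IsIntegralOverIdeal J f)
    (a : Fin r →₀ ℕ) : IsIntegralOverIdeal J (monomial a (f.coeff a)) := by
  rw [isIntegralOverIdeal_iff] at hf ⊢
  let j : MvPolynomial (Fin r) (reesAlgebra J) →+* _ :=
    map (algebraMap (reesAlgebra J) (Polynomial (MvPolynomial (Fin r) K)))
  have hj : Function.Injective j := map_injective _ Subtype.val_injective
  obtain ⟨g, hg⟩ := hj.hasLeftInverse
  -- The coaction on the Rees algebra, lifted through the injection `j`.
  let ψ : reesAlgebra J →+* MvPolynomial (Fin r) (reesAlgebra J) :=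
    ((RingEquiv.ofLeftInverseS hg).symm : _ →+* _).comp
      (((torusCoaction K r).comp (algebraMap (reesAlgebra J) _)).codRestrict j.rangeS
        (torusCoaction_mem_range hJ))
  have hψ : (algebraMap (MvPolynomial (Fin r) (reesAlgebra J))
      (MvPolynomial (Fin r) (Polynomial (MvPolynomial (Fin r) K)))).comp ψ =
      (torusCoaction K r).comp (algebraMap (reesAlgebra J) _) := by
    ext1 x
    exact congrArg Subtype.val (RingEquiv.apply_symm_apply (RingEquiv.ofLeftInverseS hg)
      ⟨torusCoaction K r x, torusCoaction_mem_range hJ x⟩)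
  have h := MvPolynomial.isIntegral_iff_isIntegral_coeff.mp (hf.map_of_comp_eq ψ _ hψ) a
  suffices e : Polynomial.monomial 1 (monomial a (f.coeff a)) =
      (torusCoaction K r (Polynomial.monomial 1 f)).coeff a by rwa [e]
  ext1 k
  rw [coeff_coeff_torusCoaction]
  by_cases hk : 1 = k <;> simp [hk, Polynomial.coeff_monomial]

/-! ### General properties of integral closure, and integral monomials. -/

theorem isIntegralOverIdeal_of_pow_mem {R : Type u} [CommRing R] {J : Ideal R} {x : R} {n : ℕ}
    (hn : 1 ≤ n) (h : x ^ n ∈ J ^ n) : IsIntegralOverIdeal J x := by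
  classical
  refine ⟨n, fun i => if i = n then -x ^ n else 0, hn, fun i _ _ => ?_, ?_⟩
  · dsimp only
    split_ifs with hi
    · rw [hi]
      exact neg_mem h
    · exact zero_mem _
  · rw [Finset.sum_eq_single n] <;> simp +contextual [hn]

theorem le_integralClosureIdeal {R : Type u} [CommRing R] (J : Ideal R) :
    J ≤ integralClosureIdeal J := fun x hx =>
  isIntegralOverIdeal_of_pow_mem (n := 1) le_rfl (by simpa using hx)

theorem IsIntegralOverIdeal.mono {R : Type u} [CommRing R] {J J' : Ideal R} (h : J ≤ J') {x : R}
    (hx : IsIntegralOverIdeal J x) : IsIntegralOverIdeal J' x := by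
  obtain ⟨n, a, hn, ha, e⟩ := hx
  exact ⟨n, a, hn, fun i h1 h2 => Ideal.pow_right_mono h i (ha i h1 h2), e⟩

theorem integralClosureIdeal_mono {R : Type u} [CommRing R] {J J' : Ideal R} (h : J ≤ J') :
    integralClosureIdeal J ≤ integralClosureIdeal J' := fun _ hx => hx.mono h

/-- In the Rees picture this is closure of integral elements under products: `x T ^ k` times `y T ^
l` is `x y T ^ (k + l)`. -/
theorem integralClosureIdeal_pow_mul_le {R : Type u} [CommRing R] (J : Ideal R) (k l : ℕ) :
    integralClosureIdeal (J ^ k) * integralClosureIdeal (J ^ l) ≤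
      integralClosureIdeal (J ^ (k + l)) := by
  rw [Ideal.mul_le]
  intro x hx y hy
  rw [mem_integralClosureIdeal, isIntegralOverIdeal_pow_iff] at *
  rw [← Polynomial.monomial_mul_monomial]
  exact hx.mul hy

theorem IsIntegralOverIdeal.mem_of_isPrime {R : Type u} [CommRing R] {J P : Ideal R} [P.IsPrime]
    (h : J ≤ P) {x : R} (hx : IsIntegralOverIdeal J x) : x ∈ P := by
  obtain ⟨n, a, hn, ha, e⟩ := hx
  refine Ideal.IsPrime.mem_of_pow_mem ‹_› n ?_
  rw [eq_neg_of_add_eq_zero_left e]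
  refine neg_mem (sum_mem fun i hi => P.mul_mem_right _ ?_)
  rw [Finset.mem_Icc] at hi
  exact Ideal.pow_le_self (by omega) (Ideal.pow_right_mono h i (ha i hi.1 hi.2))

/-- Over a monomial ideal, a monomial satisfies a binomial equation of integral dependence. -/
theorem IsMonomialIdeal.exists_pow_mem {J : Ideal (MvPolynomial (Fin r) K)}
    (hJ : IsMonomialIdeal J) {a : Fin r →₀ ℕ} (h : IsIntegralOverIdeal J (monomial a (1 : K))) :
    ∃ n, 1 ≤ n ∧ monomial (n • a) (1 : K) ∈ J ^ n := by
  obtain ⟨n, c, hn, hc, e⟩ := h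
  by_contra! hcon
  -- Compare coefficients at `n • a`. The leading term contributes `1`, so some `c i` must have a
  -- nonzero coefficient at `i • a`; as `J ^ i` is monomial, that puts the monomial `i • a` in `J ^
  -- i`.
  have e' := congrArg (coeff (n • a)) e
  rw [coeff_add, coeff_sum, Finset.sum_eq_zero, monomial_pow, one_pow, coeff_monomial,
    if_pos rfl] at e'
  · simp at e'
  intro i hi
  rw [Finset.mem_Icc] at hi
  rw [monomial_pow, one_pow, show n • a = i • a + (n - i) • a by rw [← add_smul]; congr 1; omega,
    coeff_mul_monomial, mul_one]
  by_contra h0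
  exact hcon i hi.1 ((hJ.pow i).monomial_mem (hc i hi.1 hi.2) (mem_support_iff.mpr h0))

theorem IsMonomialIdeal.integralClosureIdeal {J : Ideal (MvPolynomial (Fin r) K)}
    (hJ : IsMonomialIdeal J) : IsMonomialIdeal (integralClosureIdeal J) := by
  refine ⟨{a | monomial a (1 : K) ∈ IntClosure.integralClosureIdeal J}, le_antisymm ?_ ?_⟩
  · intro f hf
    rw [mem_ideal_span_monomial_image]
    intro a ha
    refine ⟨a, ?_, le_rfl⟩
    have h := Ideal.mul_mem_left (IntClosure.integralClosureIdeal J) (C (f.coeff a)⁻¹)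
      (hJ.isIntegralOverIdeal_monomial hf a)
    rwa [C_mul_monomial, inv_mul_cancel₀ (mem_support_iff.mp ha)] at h
  · rw [Ideal.span_le]
    rintro _ ⟨a, ha, rfl⟩
    exact ha

/-! ### Division of integral monomials by a variable. -/

theorem exists_le_card_eq {α : Type*} {m : Multiset α} {n : ℕ} (hn : n ≤ m.card) :
    ∃ t ≤ m, t.card = n := by
  induction m using Quotient.inductionOn with
  | h l => exact ⟨l.take n, (List.take_sublist n l).subperm, by simpa using hn⟩

/-- Fill `t` greedily with elements satisfying `p`: either they suffice for all of `t`, or `t` uses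
them up and none remain in `u`. -/
theorem exists_le_of_filter {α : Type*} (m : Multiset α) (p : α → Prop) [DecidablePred p] {n : ℕ}
    (hn : n ≤ m.card) : ∃ t u : Multiset α, t + u = m ∧ t.card = n ∧
      (n ≤ (t.filter p).card ∨ ∀ a ∈ u, ¬ p a) := by
  have hpn := Multiset.filter_add_not p m
  have hc := congrArg Multiset.card hpn
  rw [Multiset.card_add] at hc
  rcases le_total n (m.filter p).card with h | h
  · obtain ⟨t, ht, htn⟩ := exists_le_card_eq h
    obtain ⟨u, rfl⟩ := Multiset.le_iff_exists_add.mp (ht.trans (Multiset.filter_le _ _))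
    refine ⟨t, u, rfl, htn, Or.inl ?_⟩
    rw [Multiset.filter_eq_self.mpr fun a ha => Multiset.of_mem_filter (Multiset.mem_of_le ht ha)]
    exact htn.ge
  · obtain ⟨t, ht, htn⟩ := exists_le_card_eq
      (show n - (m.filter p).card ≤ (m.filter fun a => ¬ p a).card by omega)
    obtain ⟨u, hu⟩ := Multiset.le_iff_exists_add.mp ht
    refine ⟨m.filter p + t, u, ?_, ?_, Or.inr fun a ha => ?_⟩
    · rw [add_assoc, ← hu, hpn]
    · rw [Multiset.card_add, htn]
      omega
    · have h1 : a ∈ m.filter fun a => ¬ p a := hu ▸ Multiset.mem_add.mpr (Or.inr ha)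
      exact (Multiset.mem_filter.mp h1).2

theorem IsMonomialIdeal.monomial_sub_single_mem {I : Ideal (MvPolynomial (Fin r) K)}
    (hI : IsMonomialIdeal I) {k : ℕ} (hk : 1 ≤ k) {a : Fin r →₀ ℕ} (i : Fin r)
    (h : monomial a (1 : K) ∈ IntClosure.integralClosureIdeal (I ^ k)) :
    monomial (a - Finsupp.single i 1) (1 : K) ∈
      IntClosure.integralClosureIdeal (I ^ (k - 1)) := by
  classical
  obtain ⟨n, hn, hmem⟩ := (hI.pow k).exists_pow_mem h
  obtain ⟨s, rfl⟩ := hI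
  refine isIntegralOverIdeal_of_pow_mem hn ?_
  rw [← pow_mul, span_monomial_pow, mem_ideal_span_monomial_image] at hmem
  obtain ⟨_, ⟨m, hmc, hms, rfl⟩, hle⟩ := hmem (n • a) (by simp)
  rw [monomial_pow, one_pow, ← pow_mul, span_monomial_pow, mem_ideal_span_monomial_image]
  intro b hb
  rw [support_monomial, if_neg one_ne_zero, Finset.mem_singleton] at hb
  subst hb
  -- Of the `k * n` generators, `t` holds the `n` to discard, with preference for those divisible by
  -- `x_i`; the `(k - 1) * n` generators in `v` remain.
  obtain ⟨t, v, rfl, htc, hcase⟩ := exists_le_of_filter m (fun g => 1 ≤ g i) (n := n)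
    (by rw [hmc]; nlinarith)
  refine ⟨v.sum, ⟨v, ?_, fun g hg => hms g (by simp [hg]), rfl⟩, fun j => ?_⟩
  · rw [Multiset.card_add, htc] at hmc
    obtain ⟨k, rfl⟩ := Nat.exists_eq_add_of_le' hk
    rw [Nat.add_sub_cancel]
    linarith [add_mul k 1 n]
  have hlej := hle j
  simp only [Multiset.sum_add, Finsupp.coe_add, Pi.add_apply, Finsupp.coe_smul, Pi.smul_apply,
    smul_eq_mul, Finsupp.coe_tsub, Pi.sub_apply] at hlej ⊢
  by_cases hj : i = j
  · subst hj
    have hsum : ∀ w : Multiset (Fin r →₀ ℕ), w.sum i = (w.map fun g => g i).sum := fun w =>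
      map_multiset_sum (Finsupp.applyAddHom i) w
    rw [Finsupp.single_eq_same, Nat.mul_sub, mul_one]
    rcases hcase with hc | hc
    -- All of `t` is divisible by `x_i`, so discarding it lowers the exponent of `x_i` by at least
    -- `n`.
    · have h1 : n ≤ t.sum i := by
        rw [hsum]
        refine hc.trans ?_
        have h2 : ∀ w : Multiset (Fin r →₀ ℕ), (w.filter fun g => 1 ≤ g i).card ≤
            (w.map fun g => g i).sum := by
          intro w
          induction w using Multiset.induction with
          | empty => simp
          | cons g w ih =>
            rw [Multiset.filter_cons, Multiset.map_cons, Multiset.sum_cons, Multiset.card_add]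
            split_ifs with hg
            · simpa using add_le_add hg ih
            · simpa using ih.trans (Nat.le_add_left _ _)
        exact h2 t
      omega
    -- No remaining generator involves `x_i`, so truncated subtraction does no harm.
    · have h1 : v.sum i = 0 := by
        rw [hsum]
        refine Multiset.sum_eq_zero fun x hx => ?_
        obtain ⟨g, hg, rfl⟩ := Multiset.mem_map.mp hx
        have := hc g hg
        omega
      rw [h1]
      exact Nat.zero_le _
  · rw [Finsupp.single_eq_of_ne (Ne.symm hj), Nat.sub_zero]
    exact (Nat.le_add_left _ _).trans hlej

/-! ### The maximal ideal and the monomials in it. -/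

theorem isPrime_maxIdeal : (maxIdeal K r).IsPrime := by
  have h : maxIdeal K r = RingHom.ker (constantCoeff (R := K) (σ := Fin r)) := by
    ext p
    rw [← pow_one (maxIdeal K r), mem_pow_idealOfVars_iff', RingHom.mem_ker, constantCoeff_eq]
    refine ⟨fun h => h 0 (by simp), fun h x hx => ?_⟩
    rw [Nat.lt_one_iff, Finsupp.degree_eq_zero_iff] at hx
    rw [hx, h]
  rw [h]
  exact RingHom.ker_isPrime _

theorem IsMonomialIdeal.le_maxIdeal {I : Ideal (MvPolynomial (Fin r) K)} (hI : IsMonomialIdeal I)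
    (h : I ≠ ⊤) : I ≤ maxIdeal K r := by
  intro f hf
  rw [← pow_one (maxIdeal K r), mem_pow_idealOfVars_iff]
  intro a ha
  by_contra h0
  rw [not_le, Nat.lt_one_iff, Finsupp.degree_eq_zero_iff] at h0
  exact h ((Ideal.eq_top_iff_one _).mpr (by simpa [h0] using hI.monomial_mem hf ha))

theorem IsMonomialIdeal.integralClosureIdeal_pow_le_maxIdeal
    {I : Ideal (MvPolynomial (Fin r) K)} (hI : IsMonomialIdeal I) (h : I ≠ ⊤) {k : ℕ}
    (hk : 1 ≤ k) : IntClosure.integralClosureIdeal (I ^ k) ≤ maxIdeal K r := fun _ hx =>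
  have := isPrime_maxIdeal (K := K) (r := r)
  hx.mem_of_isPrime ((Ideal.pow_le_self (by omega)).trans (hI.le_maxIdeal h))

/-- `Q ≤ 𝔪 Q'` if dividing the monomials of `Q ≤ 𝔪` by variables gives elements of `Q'`. -/
theorem IsMonomialIdeal.le_maxIdeal_mul {Q Q' : Ideal (MvPolynomial (Fin r) K)}
    (hQ : IsMonomialIdeal Q) (hm : Q ≤ maxIdeal K r)
    (h : ∀ (a : Fin r →₀ ℕ) (i : Fin r), monomial a (1 : K) ∈ Q →
      monomial (a - Finsupp.single i 1) (1 : K) ∈ Q') : Q ≤ maxIdeal K r * Q' := by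
  intro f hf
  rw [f.as_sum]
  refine sum_mem fun a ha => monomial_mem_of_one ?_ _
  have haQ := hQ.monomial_mem hf ha
  have h1 := hm haQ
  rw [← pow_one (maxIdeal K r), monomial_mem_pow_idealOfVars_iff _ _ one_ne_zero] at h1
  obtain ⟨i, hi⟩ : ∃ i, a i ≠ 0 := by
    by_contra! h0
    have : a = 0 := Finsupp.ext h0
    simp [this] at h1
  have hi : 1 ≤ a i := Nat.one_le_iff_ne_zero.mpr hi
  have e : monomial a (1 : K) = X i * monomial (a - Finsupp.single i 1) 1 := by
    rw [X, monomial_mul, one_mul, add_tsub_cancel_of_le (Finsupp.single_le_iff.mpr hi)]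
  rw [e]
  exact Ideal.mul_mem_mul (Ideal.subset_span ⟨i, rfl⟩) (h a i haQ)

end Torus

end IntClosure

namespace IntClosure

open MvPolynomial

/-! ### Signs in the Koszul complex. -/

section KoszulSign

variable {r : ℕ}

/-- The sign of `s` in the Koszul differential of the basis element indexed by `S`. -/
def koszulSign (s : Fin r) (S : Finset (Fin r)) : ℤ := (-1) ^ (S.filter (· < s)).card

theorem koszulSign_eq_one {s : Fin r} {S : Finset (Fin r)} (h : ∀ i ∈ S, s ≤ i) :
    koszulSign s S = 1 := by
  rw [koszulSign, Finset.filter_eq_empty_iff.mpr fun i hi => (h i hi).not_gt, Finset.card_empty,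
    pow_zero]

theorem koszulSign_insert_of_lt {s j : Fin r} {S : Finset (Fin r)} (hj : j ∉ S) (h : j < s) :
    koszulSign s (insert j S) = -koszulSign s S := by
  rw [koszulSign, koszulSign, Finset.filter_insert, if_pos h,
    Finset.card_insert_of_notMem fun h => hj (Finset.mem_filter.mp h).1, pow_succ, mul_neg_one]

theorem koszulSign_erase_of_lt {s j : Fin r} {S : Finset (Fin r)} (hj : j ∈ S) (h : j < s) :
    koszulSign s (S.erase j) = -koszulSign s S := by
  conv_rhs => rw [← Finset.insert_erase hj]
  rw [koszulSign_insert_of_lt (Finset.notMem_erase j S) h, neg_neg]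

theorem koszulSign_erase_of_gt {s j : Fin r} {S : Finset (Fin r)} (h : s < j) :
    koszulSign s (S.erase j) = koszulSign s S := by
  rw [koszulSign, koszulSign, Finset.filter_erase, Finset.erase_eq_of_notMem]
  simp [h.le]

/-- Erasing the smaller index flips the sign of the larger one, and not conversely; this is what
makes the differential square to zero. -/
theorem koszulSign_mul_koszulSign_erase {s t : Fin r} {S : Finset (Fin r)} (hs : s ∈ S)
    (ht : t ∈ S) (h : s ≠ t) : koszulSign s S * koszulSign t (S.erase s) =
      -(koszulSign t S * koszulSign s (S.erase t)) := by
  rcases lt_or_gt_of_ne h with h | h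
  · rw [koszulSign_erase_of_lt hs h, koszulSign_erase_of_gt h]
    ring
  · rw [koszulSign_erase_of_lt ht h, koszulSign_erase_of_gt h]
    ring

end KoszulSign

/-! ### The Koszul differential and its contracting homotopy. -/

section Koszul

variable (K : Type u) [Field K] (r : ℕ)

/-- The Koszul algebra on the variables, as a free module on the subsets of the variables. -/
abbrev KoszulModule : Type u := Finset (Fin r) →₀ MvPolynomial (Fin r) K

/-- The Koszul differential. -/
noncomputable def koszulD : KoszulModule K r →ₗ[MvPolynomial (Fin r) K] KoszulModule K r :=
  Finsupp.linearCombination _ fun S =>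
    ∑ s ∈ S, koszulSign s S • Finsupp.single (S.erase s) (X s : MvPolynomial (Fin r) K)

/-- The value of the contracting homotopy of the Koszul complex on the element of its monomial
basis that is given by the subset `S` and the exponent `b`. -/
noncomputable def koszulHomotopyBasis (S : Finset (Fin r)) (b : Fin r →₀ ℕ) : KoszulModule K r :=
  if h : (b.support ∪ S).Nonempty then
    if (b.support ∪ S).min' h ∈ S then 0
    else Finsupp.single (insert ((b.support ∪ S).min' h) S)
      (monomial (b - Finsupp.single ((b.support ∪ S).min' h) 1) 1)
  else 0

/-- The contracting homotopy of the Koszul complex: in a nonzero multidegree it is exterior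
multiplication by the first variable of the multidegree, divided by that variable. -/
noncomputable def koszulHomotopy : KoszulModule K r →ₗ[K] KoszulModule K r :=
  Finsupp.lsum K fun S => (basisMonomials (Fin r) K).constr K (koszulHomotopyBasis K r S)

variable {K r}

theorem koszulD_single (S : Finset (Fin r)) (p : MvPolynomial (Fin r) K) :
    koszulD K r (Finsupp.single S p) =
      ∑ s ∈ S, koszulSign s S • Finsupp.single (S.erase s) (p * X s) := by
  rw [koszulD, Finsupp.linearCombination_single, Finset.smul_sum]
  refine Finset.sum_congr rfl fun s _ => ?_
  rw [smul_comm, Finsupp.smul_single, smul_eq_mul]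

theorem koszulD_single_monomial (S : Finset (Fin r)) (b : Fin r →₀ ℕ) (c : K) :
    koszulD K r (Finsupp.single S (monomial b c)) =
      ∑ s ∈ S, koszulSign s S •
        Finsupp.single (S.erase s) (monomial (b + Finsupp.single s 1) c) := by
  rw [koszulD_single]
  refine Finset.sum_congr rfl fun s _ => ?_
  rw [X, monomial_mul, mul_one]

theorem koszulHomotopy_single_monomial (S : Finset (Fin r)) (b : Fin r →₀ ℕ) (c : K) :
    koszulHomotopy K r (Finsupp.single S (monomial b c)) = c • koszulHomotopyBasis K r S b := by
  rw [koszulHomotopy, Finsupp.lsum_single, ← mul_one c, ← smul_eq_mul, ← smul_monomial, map_smul,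
    ← congrFun (coe_basisMonomials (Fin r) K) b, Module.Basis.constr_basis, smul_eq_mul, mul_one]

theorem min'_eq_of_forall_le {s : Finset (Fin r)} {j : Fin r} (hj : j ∈ s) (h : ∀ i ∈ s, j ≤ i) :
    s.min' ⟨j, hj⟩ = j :=
  le_antisymm (Finset.min'_le _ _ hj) (Finset.le_min' _ _ _ h)

theorem koszulHomotopy_single_monomial_of_mem {S : Finset (Fin r)} {b : Fin r →₀ ℕ} {j : Fin r}
    (hj : j ∈ S) (hmin : ∀ i ∈ b.support ∪ S, j ≤ i) (c : K) :
    koszulHomotopy K r (Finsupp.single S (monomial b c)) = 0 := by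
  have hj' : j ∈ b.support ∪ S := Finset.mem_union_right _ hj
  rw [koszulHomotopy_single_monomial, koszulHomotopyBasis, dif_pos ⟨j, hj'⟩,
    min'_eq_of_forall_le hj' hmin, if_pos hj, smul_zero]

theorem koszulHomotopy_single_monomial_of_notMem {S : Finset (Fin r)} {b : Fin r →₀ ℕ} {j : Fin r}
    (hj : j ∉ S) (hjb : j ∈ b.support) (hmin : ∀ i ∈ b.support ∪ S, j ≤ i) (c : K) :
    koszulHomotopy K r (Finsupp.single S (monomial b c)) =
      Finsupp.single (insert j S) (monomial (b - Finsupp.single j 1) c) := by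
  have hj' : j ∈ b.support ∪ S := Finset.mem_union_left _ hjb
  rw [koszulHomotopy_single_monomial, koszulHomotopyBasis, dif_pos ⟨j, hj'⟩,
    min'_eq_of_forall_le hj' hmin, if_neg hj, Finsupp.smul_single, smul_monomial, smul_eq_mul,
    mul_one]

theorem koszulHomotopy_single_empty (c : K) :
    koszulHomotopy K r (Finsupp.single ∅ (monomial 0 c)) = 0 := by
  rw [koszulHomotopy_single_monomial, koszulHomotopyBasis, dif_neg (by simp), smul_zero]

theorem koszulD_koszulD (f : KoszulModule K r) : koszulD K r (koszulD K r f) = 0 := by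
  induction f using Finsupp.induction_linear with
  | zero => simp
  | add f g hf hg => rw [map_add, map_add, hf, hg, add_zero]
  | single S p =>
    simp only [koszulD_single, map_sum, map_zsmul, Finset.smul_sum, smul_smul]
    rw [Finset.sum_sigma']
    refine Finset.sum_involution (fun x _ => ⟨x.2, x.1⟩) ?_ ?_ ?_ ?_
    · rintro ⟨s, t⟩ h
      simp only [Finset.mem_sigma, Finset.mem_erase] at h
      dsimp only
      rw [Finset.erase_right_comm, mul_right_comm p, koszulSign_mul_koszulSign_erase h.1 h.2.2
        (Ne.symm h.2.1), neg_smul, neg_add_cancel]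
    · rintro ⟨s, t⟩ h _ heq
      simp only [Finset.mem_sigma, Finset.mem_erase] at h
      exact h.2.1 (congrArg Sigma.fst heq)
    · rintro ⟨s, t⟩ h
      simp only [Finset.mem_sigma, Finset.mem_erase] at h ⊢
      exact ⟨h.2.2, Ne.symm h.2.1, h.1⟩
    · intros
      rfl

/-- Let `j` be the least variable of the multidegree. If `j ∈ S`, the homotopy kills the element and
every term of its differential except the one erasing `j`, which it sends back to the element. If `j
∉ S`, erasing the inserted `j` returns the element, and the other terms cancel because inserting `j`
flips their signs. -/
theorem koszulD_koszulHomotopy_single_monomial {S : Finset (Fin r)} {b : Fin r →₀ ℕ} (c : K)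
    (hne : (b.support ∪ S).Nonempty) :
    koszulD K r (koszulHomotopy K r (Finsupp.single S (monomial b c))) +
      koszulHomotopy K r (koszulD K r (Finsupp.single S (monomial b c))) =
        Finsupp.single S (monomial b c) := by
  obtain ⟨j, hj, hmin⟩ : ∃ j ∈ b.support ∪ S, ∀ i ∈ b.support ∪ S, j ≤ i :=
    ⟨_, Finset.min'_mem _ hne, fun i hi => Finset.min'_le _ _ hi⟩
  have hminS : ∀ i ∈ S, j ≤ i := fun i hi => hmin i (Finset.mem_union_right _ hi)
  -- The differential preserves the multidegree, so `j` stays a lower bound.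
  have hmin' : ∀ s ∈ S, ∀ i ∈ (b + Finsupp.single s 1).support ∪ S.erase s, j ≤ i := by
    intro s hs i hi
    rcases Finset.mem_union.mp hi with hi | hi
    · rcases Finset.mem_union.mp (Finsupp.support_add hi) with hi | hi
      · exact hmin i (Finset.mem_union_left _ hi)
      · rw [Finset.mem_singleton.mp (Finsupp.support_single_subset hi)]
        exact hminS s hs
    · exact hminS i (Finset.mem_of_mem_erase hi)
  simp only [koszulD_single_monomial, map_sum, map_zsmul]
  by_cases hjS : j ∈ S
  · rw [koszulHomotopy_single_monomial_of_mem hjS hmin, map_zero, zero_add,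
      Finset.sum_eq_single_of_mem j hjS, koszulSign_eq_one hminS, one_smul,
      koszulHomotopy_single_monomial_of_notMem (Finset.notMem_erase j S) (by simp) (hmin' j hjS),
      Finset.insert_erase hjS, add_tsub_cancel_right]
    intro s hs hsj
    rw [koszulHomotopy_single_monomial_of_mem (Finset.mem_erase.mpr ⟨Ne.symm hsj, hjS⟩)
      (hmin' s hs), smul_zero]
  · have hjb : j ∈ b.support := (Finset.mem_union.mp hj).resolve_right hjS
    have hjb' : Finsupp.single j 1 ≤ b := by
      rw [Finsupp.single_le_iff]
      exact Nat.one_le_iff_ne_zero.mpr (Finsupp.mem_support_iff.mp hjb)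
    rw [koszulHomotopy_single_monomial_of_notMem hjS hjb hmin, koszulD_single_monomial,
      Finset.sum_insert hjS, Finset.erase_insert hjS, koszulSign_eq_one, one_smul,
      tsub_add_cancel_of_le hjb', add_assoc, ← Finset.sum_add_distrib, Finset.sum_eq_zero,
      add_zero]
    · intro s hs
      have hsj : s ≠ j := fun h => hjS (h ▸ hs)
      rw [koszulSign_insert_of_lt hjS (lt_of_le_of_ne (hminS s hs) (Ne.symm hsj)),
        koszulHomotopy_single_monomial_of_notMem (fun h => hjS (Finset.mem_of_mem_erase h))
          (by simp [Finsupp.mem_support_iff.mp hjb]) (hmin' s hs),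
        Finset.erase_insert_of_ne (Ne.symm hsj), tsub_add_eq_add_tsub hjb', neg_smul,
        neg_add_cancel]
    · intro i hi
      rcases Finset.mem_insert.mp hi with rfl | hi
      · exact le_rfl
      · exact hminS i hi

/-- The correction term is the part of multidegree zero, where both maps vanish. -/
theorem koszulD_koszulHomotopy (f : KoszulModule K r) :
    koszulD K r (koszulHomotopy K r f) + koszulHomotopy K r (koszulD K r f) =
      f - Finsupp.single ∅ (C (constantCoeff (f ∅))) := by
  classical
  induction f using Finsupp.induction_linear with
  | zero => simp
  | add f g hf hg =>
    simp only [map_add, Finsupp.add_apply, Finsupp.single_add]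
    rw [add_add_add_comm, hf, hg]
    abel
  | single S p =>
    induction p using MvPolynomial.induction_on' with
    | add p q hp hq =>
      simp only [map_add, Finsupp.single_add, Finsupp.add_apply] at hp hq ⊢
      rw [add_add_add_comm, hp, hq]
      abel
    | monomial b c =>
      by_cases h : (b.support ∪ S).Nonempty
      · rw [koszulD_koszulHomotopy_single_monomial c h, eq_comm, sub_eq_self]
        by_cases hS : S = ∅
        · subst hS
          have hb : b ≠ 0 := by
            rintro rfl
            simp at h
          simp [constantCoeff_eq, coeff_monomial, hb]
        · simp [Finsupp.single_eq_of_ne (Ne.symm hS)]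
      · rw [Finset.not_nonempty_iff_eq_empty, Finset.union_eq_empty,
          Finsupp.support_eq_empty] at h
        obtain ⟨rfl, rfl⟩ := h
        rw [koszulHomotopy_single_empty, koszulD_single]
        simp

/-- The part of degree `i` of the Koszul algebra. -/
noncomputable def koszulPart (K : Type u) [Field K] (r i : ℕ) :
    Submodule (MvPolynomial (Fin r) K) (KoszulModule K r) :=
  Finsupp.supported _ _ {S | S.card = i}

theorem single_mem_koszulPart {S : Finset (Fin r)} {i : ℕ} (h : S.card = i)
    (p : MvPolynomial (Fin r) K) : Finsupp.single S p ∈ koszulPart K r i :=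
  Finsupp.single_mem_supported _ _ h

theorem card_eq_of_mem_koszulPart {f : KoszulModule K r} {i : ℕ} (hf : f ∈ koszulPart K r i)
    {S : Finset (Fin r)} (hS : S ∈ f.support) : S.card = i :=
  (Finsupp.mem_supported _ _).mp hf hS

theorem koszulD_mem_koszulPart {f : KoszulModule K r} {i : ℕ} (hf : f ∈ koszulPart K r (i + 1)) :
    koszulD K r f ∈ koszulPart K r i := by
  rw [← f.sum_single, Finsupp.sum, map_sum]
  refine sum_mem fun S hS => ?_
  rw [koszulD_single]
  refine sum_mem fun s hs => zsmul_mem (single_mem_koszulPart ?_ _) _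
  rw [Finset.card_erase_of_mem hs, card_eq_of_mem_koszulPart hf hS, Nat.add_sub_cancel]

/-- A sum of values of the homotopy on monomials lies in any submodule that contains those
values. -/
theorem koszulHomotopy_mem (N : Submodule (MvPolynomial (Fin r) K) (KoszulModule K r))
    {f : KoszulModule K r} (h : ∀ S, ∀ b ∈ (f S).support, ∀ j ∉ S, b j ≠ 0 →
      Finsupp.single (insert j S) (monomial (b - Finsupp.single j 1) (1 : K)) ∈ N) :
    koszulHomotopy K r f ∈ N := by
  rw [← f.sum_single, Finsupp.sum, map_sum]
  refine sum_mem fun S hS => ?_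
  rw [(f S).as_sum, Finsupp.single_finsetSum, map_sum]
  refine sum_mem fun b hb => ?_
  rw [koszulHomotopy_single_monomial]
  refine Submodule.smul_of_tower_mem _ _ ?_
  rw [koszulHomotopyBasis]
  split_ifs with hne hj
  · exact N.zero_mem
  · refine h S b hb _ hj ?_
    rw [← Finsupp.mem_support_iff]
    exact (Finset.mem_union.mp (Finset.min'_mem _ hne)).resolve_right hj
  · exact N.zero_mem

theorem koszulHomotopy_mem_koszulPart {f : KoszulModule K r} {i : ℕ}
    (hf : f ∈ koszulPart K r i) : koszulHomotopy K r f ∈ koszulPart K r (i + 1) := by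
  refine koszulHomotopy_mem _ fun S b hb j hj _ => single_mem_koszulPart ?_ _
  rw [Finset.card_insert_of_notMem hj, card_eq_of_mem_koszulPart hf]
  rw [Finsupp.mem_support_iff]
  intro h
  simp [h] at hb

/-- The homotopy is only `K`-linear, but `Q` is monomial, so coefficients split into monomials of
`Q`, each of which is sent to zero or divided by one variable. -/
theorem koszulHomotopy_apply_mem {Q Q' : Ideal (MvPolynomial (Fin r) K)} (hQ : IsMonomialIdeal Q)
    (h : ∀ (a : Fin r →₀ ℕ) (i : Fin r), monomial a (1 : K) ∈ Q →
      monomial (a - Finsupp.single i 1) (1 : K) ∈ Q') {f : KoszulModule K r}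
    (hf : ∀ S, f S ∈ Q) (S : Finset (Fin r)) : koszulHomotopy K r f S ∈ Q' := by
  refine koszulHomotopy_mem (Submodule.comap (Finsupp.lapply S) Q') fun T b hb j _ _ => ?_
  rw [Submodule.mem_comap, Finsupp.lapply_apply, Finsupp.single_apply]
  split_ifs
  · exact h b j (hQ.monomial_mem (hf T) hb)
  · exact Q'.zero_mem

theorem koszul_apply_empty {f : KoszulModule K r} {i : ℕ} (hf : f ∈ koszulPart K r (i + 1)) :
    f ∅ = 0 := by
  by_contra h
  simpa using card_eq_of_mem_koszulPart hf (Finsupp.mem_support_iff.mpr h)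

theorem koszulD_eq_zero_of_mem {f : KoszulModule K r} (hf : f ∈ koszulPart K r 0) :
    koszulD K r f = 0 := by
  rw [← f.sum_single, Finsupp.sum, map_sum]
  refine Finset.sum_eq_zero fun S hS => ?_
  rw [Finset.card_eq_zero.mp (card_eq_of_mem_koszulPart hf hS), koszulD_single, Finset.sum_empty]

end Koszul

end IntClosure

namespace IntClosure

open MvPolynomial CategoryTheory MonoidalCategory

open scoped TensorProduct

/-- A chain map that sends cycles to boundaries is zero on homology. -/
theorem homologyMap_eq_zero_of_cycles {R : Type u} [Ring R] {C D : ChainComplex (ModuleCat.{u} R) ℕ}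
    (f : C ⟶ D) (i : ℕ)
    (h : ∀ z : C.X i, C.d i ((ComplexShape.down ℕ).next i) z = 0 →
      ∃ w : D.X (i + 1), D.d (i + 1) i w = f.f i z) :
    HomologicalComplex.homologyMap f i = 0 := by
  rw [← cancel_epi (C.homologyπ i), HomologicalComplex.homologyπ_naturality, Limits.comp_zero]
  ext c
  obtain ⟨w, hw⟩ := h (C.iCycles i c) (by
    rw [← ModuleCat.comp_apply, HomologicalComplex.iCycles_d]
    rfl)
  have hc : HomologicalComplex.cyclesMap f i c = D.toCycles (i + 1) i w := by
    apply (ModuleCat.mono_iff_injective (D.iCycles i)).mp inferInstance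
    rw [← ModuleCat.comp_apply, ← ModuleCat.comp_apply, HomologicalComplex.cyclesMap_i,
      HomologicalComplex.toCycles_i, hw]
    rfl
  rw [ModuleCat.hom_comp, LinearMap.comp_apply]
  change D.homologyπ i (HomologicalComplex.cyclesMap f i c) = 0
  rw [hc, ← ModuleCat.comp_apply, HomologicalComplex.toCycles_comp_homologyπ]
  rfl

/-! ### The Koszul resolution of the residue field. -/

section Resolution

variable (K : Type u) [Field K] (r : ℕ)

/-- The Koszul differential from degree `i + 1` to degree `i`. -/
noncomputable def koszulPartD (i : ℕ) :
    koszulPart K r (i + 1) →ₗ[MvPolynomial (Fin r) K] koszulPart K r i :=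
  (koszulD K r).restrict fun _ hf => koszulD_mem_koszulPart hf

/-- The Koszul complex on the variables. -/
noncomputable def koszulComplex : ChainComplex (ModuleCat.{u} (MvPolynomial (Fin r) K)) ℕ :=
  ChainComplex.of (fun i => ModuleCat.of _ (koszulPart K r i))
    (fun i => ModuleCat.ofHom (koszulPartD K r i)) fun i => by
      refine ModuleCat.hom_ext (LinearMap.ext fun f => ?_)
      exact Subtype.ext (koszulD_koszulD (K := K) (r := r) f.1)

theorem koszulComplex_d (i : ℕ) :
    (koszulComplex K r).d (i + 1) i = ModuleCat.ofHom (koszulPartD K r i) :=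
  ChainComplex.of_d (V := ModuleCat.{u} (MvPolynomial (Fin r) K))
    (fun i => ModuleCat.of _ (koszulPart K r i)) (fun i => ModuleCat.ofHom (koszulPartD K r i)) i

instance (i : ℕ) : Module.Free (MvPolynomial (Fin r) K) (koszulPart K r i) :=
  Module.Free.of_equiv (Finsupp.supportedEquivFinsupp _).symm

instance (i : ℕ) : Projective ((koszulComplex K r).X i) :=
  inferInstanceAs (Projective (ModuleCat.of _ (koszulPart K r i)))

/-- The augmentation of the Koszul complex. -/
noncomputable def koszulAugmentation : koszulPart K r 0 →ₗ[MvPolynomial (Fin r) K]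
    (MvPolynomial (Fin r) K ⧸ maxIdeal K r) :=
  (maxIdeal K r).mkQ ∘ₗ Finsupp.lapply ∅ ∘ₗ (koszulPart K r 0).subtype

variable {K r}

theorem constantCoeff_eq_zero_of_mem {p : MvPolynomial (Fin r) K} (hp : p ∈ maxIdeal K r) :
    constantCoeff p = 0 := by
  rw [← pow_one (maxIdeal K r), mem_pow_idealOfVars_iff'] at hp
  exact hp 0 (by simp)

/-- Source of every boundary below, both for exactness of the resolution and for the vanishing on
Tor. -/
theorem koszulD_koszulHomotopy_eq_self {f : KoszulModule K r}
    (hd : koszulD K r f = 0) (h0 : constantCoeff (f ∅) = 0) :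
    koszulD K r (koszulHomotopy K r f) = f := by
  have h := koszulD_koszulHomotopy f
  rwa [hd, h0, map_zero, map_zero, Finsupp.single_zero, add_zero, sub_zero] at h

theorem koszulPartD_exact (i : ℕ) :
    Function.Exact (koszulPartD K r (i + 1)) (koszulPartD K r i) := by
  intro f
  constructor
  · intro h
    exact ⟨⟨_, koszulHomotopy_mem_koszulPart f.2⟩, Subtype.ext
      (koszulD_koszulHomotopy_eq_self (congrArg Subtype.val h) (by simp [koszul_apply_empty f.2]))⟩
  · rintro ⟨g, rfl⟩
    exact Subtype.ext (koszulD_koszulD _)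

theorem koszulD_apply_mem (f : KoszulModule K r) (S : Finset (Fin r)) :
    koszulD K r f S ∈ maxIdeal K r := by
  change f ∈ Submodule.comap (koszulD K r) (Submodule.comap (Finsupp.lapply S) (maxIdeal K r))
  rw [← f.sum_single]
  refine sum_mem fun T _ => ?_
  rw [Submodule.mem_comap, koszulD_single]
  refine sum_mem fun s _ => zsmul_mem ?_ _
  rw [Submodule.mem_comap, Finsupp.lapply_apply, Finsupp.single_apply]
  split_ifs
  · exact Ideal.mul_mem_left _ _ (Ideal.subset_span ⟨s, rfl⟩)
  · exact zero_mem _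

theorem koszulAugmentation_exact :
    Function.Exact (koszulPartD K r 0) (koszulAugmentation K r) := by
  intro f
  constructor
  · intro h
    exact ⟨⟨_, koszulHomotopy_mem_koszulPart f.2⟩, Subtype.ext
      (koszulD_koszulHomotopy_eq_self (koszulD_eq_zero_of_mem f.2)
        (constantCoeff_eq_zero_of_mem ((Submodule.Quotient.mk_eq_zero _).mp h)))⟩
  · rintro ⟨g, rfl⟩
    exact (Submodule.Quotient.mk_eq_zero _).mpr (koszulD_apply_mem _ _)

theorem koszulAugmentation_surjective : Function.Surjective (koszulAugmentation K r) := by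
  intro x
  obtain ⟨p, rfl⟩ := Submodule.mkQ_surjective _ x
  refine ⟨⟨Finsupp.single ∅ p, single_mem_koszulPart rfl p⟩, ?_⟩
  simp [koszulAugmentation]

variable (K r)

/-- The Koszul resolution of the residue field. -/
noncomputable def koszulResolution : ProjectiveResolution (residueModule K r) where
  complex := koszulComplex K r
  π := ((koszulComplex K r).toSingle₀Equiv _).symm ⟨ModuleCat.ofHom (koszulAugmentation K r), by
    rw [koszulComplex_d]
    ext f
    exact koszulAugmentation_exact.apply_apply_eq_zero f⟩
  quasiIso := ⟨fun n => by
    cases n with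
    | zero =>
      rw [ChainComplex.quasiIsoAt₀_iff, ShortComplex.quasiIso_iff_of_zeros' _ rfl rfl rfl]
      constructor
      · rw [ShortComplex.moduleCat_exact_iff]
        intro x hx
        obtain ⟨y, hy⟩ := (koszulAugmentation_exact x).mp hx
        refine ⟨y, ?_⟩
        change (koszulComplex K r).d 1 0 y = x
        rw [koszulComplex_d]
        exact hy
      · rw [ModuleCat.epi_iff_surjective]
        exact koszulAugmentation_surjective
    | succ n =>
      rw [quasiIsoAt_iff_exactAt' (hL := ChainComplex.exactAt_succ_single_obj ..),
        HomologicalComplex.exactAt_iff' _ (n + 2) (n + 1) n (by simp) (by simp),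
        ShortComplex.moduleCat_exact_iff]
      intro x hx
      change (koszulComplex K r).d (n + 1) n x = 0 at hx
      rw [koszulComplex_d] at hx
      obtain ⟨y, hy⟩ := (koszulPartD_exact n x).mp hx
      refine ⟨y, ?_⟩
      change (koszulComplex K r).d (n + 2) (n + 1) y = x
      rw [koszulComplex_d]
      exact hy⟩

/-! ### The Koszul complex with coefficients in an ideal, and Tor. -/

variable {K r}

/-- The embedding of `K_i ⊗ Q` in the Koszul algebra. -/
noncomputable def koszulTensor (Q : Ideal (MvPolynomial (Fin r) K)) (i : ℕ) :
    koszulPart K r i ⊗[MvPolynomial (Fin r) K] Q →ₗ[MvPolynomial (Fin r) K] KoszulModule K r :=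
  (koszulPart K r i).subtype ∘ₗ (TensorProduct.rid _ _).toLinearMap ∘ₗ
    Q.subtype.lTensor (koszulPart K r i)

theorem koszulTensor_tmul (Q : Ideal (MvPolynomial (Fin r) K)) {i : ℕ} (f : koszulPart K r i)
    (q : Q) : koszulTensor Q i (f ⊗ₜ q) = (q : MvPolynomial (Fin r) K) • (f : KoszulModule K r) :=
  by simp [koszulTensor]

/-- The Koszul modules are free, hence flat. Identities in the tensor product can therefore be
checked in the Koszul algebra, where the homotopy lives. -/
theorem koszulTensor_injective (Q : Ideal (MvPolynomial (Fin r) K)) (i : ℕ) :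
    Function.Injective (koszulTensor Q i) :=
  Subtype.val_injective.comp ((TensorProduct.rid _ _).injective.comp
    (Module.Flat.lTensor_preserves_injective_linearMap _ Subtype.val_injective))

theorem koszulTensor_mem (Q : Ideal (MvPolynomial (Fin r) K)) {i : ℕ}
    (z : koszulPart K r i ⊗[MvPolynomial (Fin r) K] Q) : koszulTensor Q i z ∈ koszulPart K r i :=
  Subtype.prop _

theorem koszulTensor_apply_mem (Q : Ideal (MvPolynomial (Fin r) K)) {i : ℕ}
    (z : koszulPart K r i ⊗[MvPolynomial (Fin r) K] Q) (S : Finset (Fin r)) :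
    koszulTensor Q i z S ∈ Q := by
  induction z with
  | zero => simp
  | add x y hx hy =>
    rw [map_add, Finsupp.add_apply]
    exact Q.add_mem hx hy
  | tmul f q =>
    rw [koszulTensor_tmul, Finsupp.smul_apply]
    exact Q.mul_mem_right _ q.2

theorem exists_koszulTensor_eq {Q : Ideal (MvPolynomial (Fin r) K)} {i : ℕ}
    {f : KoszulModule K r} (hf : f ∈ koszulPart K r i) (hQ : ∀ S, f S ∈ Q) :
    ∃ z, koszulTensor Q i z = f := by
  change f ∈ LinearMap.range (koszulTensor Q i)
  rw [← f.sum_single]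
  refine sum_mem fun S hS => ?_
  refine ⟨⟨_, single_mem_koszulPart (card_eq_of_mem_koszulPart hf hS) 1⟩ ⊗ₜ ⟨f S, hQ S⟩, ?_⟩
  rw [koszulTensor_tmul, Finsupp.smul_single, smul_eq_mul, mul_one]

theorem koszulTensor_rTensor (Q : Ideal (MvPolynomial (Fin r) K)) {i : ℕ}
    (z : koszulPart K r (i + 1) ⊗[MvPolynomial (Fin r) K] Q) :
    koszulTensor Q i ((koszulPartD K r i).rTensor Q z) = koszulD K r (koszulTensor Q (i + 1) z) := by
  induction z with
  | zero => simp
  | add x y hx hy => simp only [map_add, hx, hy]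
  | tmul f q =>
    rw [LinearMap.rTensor_tmul, koszulTensor_tmul, koszulTensor_tmul, map_smul]
    rfl

theorem koszulTensor_lTensor_inclusion {Q Q' : Ideal (MvPolynomial (Fin r) K)} (h : Q ≤ Q')
    {i : ℕ} (z : koszulPart K r i ⊗[MvPolynomial (Fin r) K] Q) :
    koszulTensor Q' i ((Submodule.inclusion h).lTensor _ z) = koszulTensor Q i z := by
  induction z with
  | zero => simp
  | add x y hx hy => simp only [map_add, hx, hy]
  | tmul f q => rw [LinearMap.lTensor_tmul, koszulTensor_tmul, koszulTensor_tmul]; rfl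

/-- Cycles of the Koszul complex of `Q` bound in the Koszul complex of `Q'`. -/
theorem exists_rTensor_eq_lTensor_inclusion {Q Q' : Ideal (MvPolynomial (Fin r) K)}
    (hle : Q ≤ Q') (hQ : IsMonomialIdeal Q) (hm : Q ≤ maxIdeal K r)
    (h : ∀ (a : Fin r →₀ ℕ) (i : Fin r), monomial a (1 : K) ∈ Q →
      monomial (a - Finsupp.single i 1) (1 : K) ∈ Q') {i : ℕ}
    (z : koszulPart K r i ⊗[MvPolynomial (Fin r) K] Q)
    (hz : koszulD K r (koszulTensor Q i z) = 0) :
    ∃ w, (koszulPartD K r i).rTensor Q' w = (Submodule.inclusion hle).lTensor _ z := by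
  obtain ⟨w, hw⟩ := exists_koszulTensor_eq (koszulHomotopy_mem_koszulPart (koszulTensor_mem Q z))
    (koszulHomotopy_apply_mem hQ h (koszulTensor_apply_mem Q z))
  refine ⟨w, koszulTensor_injective Q' i ?_⟩
  rw [koszulTensor_rTensor, hw, koszulTensor_lTensor_inclusion]
  -- Since `Q` lies in the maximal ideal, the correction term vanishes in degree zero too.
  exact koszulD_koszulHomotopy_eq_self hz
    (constantCoeff_eq_zero_of_mem (hm (koszulTensor_apply_mem Q z ∅)))

theorem isTorVanishing_inclusion {Q Q' : Ideal (MvPolynomial (Fin r) K)}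
    (hle : Q ≤ Q') (hQ : IsMonomialIdeal Q) (hm : Q ≤ maxIdeal K r)
    (h : ∀ (a : Fin r →₀ ℕ) (i : Fin r), monomial a (1 : K) ∈ Q →
      monomial (a - Finsupp.single i 1) (1 : K) ∈ Q') :
    IsTorVanishing (Submodule.inclusion hle) := by
  intro i
  change (NatTrans.leftDerived ((tensoringRight (ModuleCat.{u} (MvPolynomial (Fin r) K))).map
    (ModuleCat.ofHom (Submodule.inclusion hle))) i).app (residueModule K r) = 0
  -- Up to isomorphisms on both sides, the map on Tor is the homology map on the tensored Koszul
  -- complexes.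
  rw [ProjectiveResolution.leftDerived_app_eq _ (koszulResolution K r)]
  suffices hs : (HomologicalComplex.homologyFunctor _ (ComplexShape.down ℕ) i).map
      ((NatTrans.mapHomologicalComplex
        ((tensoringRight (ModuleCat.{u} (MvPolynomial (Fin r) K))).map
          (ModuleCat.ofHom (Submodule.inclusion hle))) _).app (koszulResolution K r).complex) = 0 by
    rw [hs, Limits.zero_comp, Limits.comp_zero]
  apply homologyMap_eq_zero_of_cycles
  intro z hz
  obtain ⟨w, hw⟩ := exists_rTensor_eq_lTensor_inclusion hle hQ hm h (i := i) z (by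
    cases i with
    -- In degree zero every element is a cycle.
    | zero => exact koszulD_eq_zero_of_mem (koszulTensor_mem Q _)
    | succ i =>
      rw [ChainComplex.next_nat_succ] at hz
      change ((koszulComplex K r).d (i + 1) i ▷ ModuleCat.of _ Q) z = 0 at hz
      rw [koszulComplex_d] at hz
      exact (koszulTensor_rTensor Q z).symm.trans
        ((congrArg (koszulTensor Q i) hz).trans (map_zero _)))
  refine ⟨w, ?_⟩
  change ((koszulComplex K r).d (i + 1) i ▷ ModuleCat.of _ Q') w = _
  rw [koszulComplex_d]
  exact hw

end Resolution

end IntClosure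

theorem lemma3p5 {K : Type u} [Field K] {r : ℕ} (I : Ideal (MvPolynomial (Fin r) K))
    (hI : IntClosure.IsMonomialIdeal I) (hI_proper : I ≠ ⊤) :
    IntClosure.IsTorVanishingFiltration (fun k => IntClosure.integralClosureIdeal (I ^ k)) ∧
    (∀ k : ℕ, 1 ≤ k → IntClosure.integralClosureIdeal (I ^ k) ≤
      IntClosure.maxIdeal K r * IntClosure.integralClosureIdeal (I ^ (k - 1))) ∧
    (∀ k : ℕ, 1 ≤ k → IntClosure.deltaStar (IntClosure.integralClosureIdeal (I ^ k)) ≤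
      IntClosure.integralClosureIdeal (I ^ (k - 1))) := by
  refine ⟨⟨?_, fun k => IntClosure.integralClosureIdeal_mono (Ideal.pow_le_pow_right k.le_succ),
    IntClosure.integralClosureIdeal_pow_mul_le I, fun k => ?_⟩, fun k hk => ?_, fun k hk => ?_⟩
  · rw [eq_top_iff, pow_zero, Ideal.one_eq_top]
    exact IntClosure.le_integralClosureIdeal ⊤
  · exact IntClosure.isTorVanishing_inclusion _ (hI.pow _).integralClosureIdeal
      (hI.integralClosureIdeal_pow_le_maxIdeal hI_proper k.succ_pos)
      fun a i => hI.monomial_sub_single_mem k.succ_pos i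
  · exact (hI.pow k).integralClosureIdeal.le_maxIdeal_mul
      (hI.integralClosureIdeal_pow_le_maxIdeal hI_proper hk)
      fun a i => hI.monomial_sub_single_mem hk i
  · rw [IntClosure.deltaStar, Ideal.span_le]
    rintro _ ⟨a, i, ha, -, rfl⟩
    exact hI.monomial_sub_single_mem hk i ha.prop
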